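/- **Setting.** Let $A\in\mathbb{Z}^{m\times n}$, $c\in\mathbb{Z}^n$, and let $\mathcal I=\{1,\dots,|\mathcal I|\}\subseteq\{1,\dots,m\}$ be nonempty. Let $\epsilon$ be an arbitrarily small positive indeterminate and $\vec\epsilon=(1,\epsilon,\dots,\epsilon^{m-1})'$, so that quantities $v'\vec\epsilon$ are compared by the lexicographic order of their coefficient vectors $v$. Consider $$(\text{lex-D}_{\mathcal I})\qquad \max\{\,y'\vec\epsilon \;:\; y'A\le c',\ y_i\in\mathbb{Z}\text{ for } i\in\mathcal I\,\},$$ its continuous relaxation lex-D (drop the integrality constraints), and the dual of the latter, $(\text{lex-P})\ \min\{c'x : Ax=\vec\epsilon,\ x\ge \mathbf 0\}$. For a basis $\beta$ (an ordered choice of $m$ columns with $A_\beta$ invertible) write $h_{l\cdot}$ and $h_{\cdot i}$ for the rows and columns of $A_\beta^{-1}$, and $\bar y'=c_\beta'A_\beta^{-1}$ for the dual basic solution. The basis is optimal for lex-P if every row $h_{l\cdot}$ is lexicographically nonnegative (primal feasibility) and all reduced costs $c_j-\bar y'A_j$ are nonnegative. **Algorithm 1.** Start with an optimal basis of lex-P.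 1. Let $\bar y$ be the dual basic solution of the current optimal basis $\beta$. If $\bar y_i\in\mathbb{Z}$ for all $i\in\mathcal I$, stop and return $\bar y$. 2. Otherwise let $i\in\mathcal I$ be the least index with $\bar y_i\notin\mathbb{Z}$, and let $r$ be the minimal vector with $r\in\mathbb{Z}^m$, $r\ge -h_{\cdot i}$, $r\ge\mathbf 0$. Append to lex-P the F-GMI column $$A_\beta r-(\bar y_i-\lfloor\bar y_i\rfloor-1)e_i\quad\text{with cost}\quad c_\beta' r-(\bar y_i-\lfloor\bar y_i\rfloor-1)\lfloor\bar y_i\rfloor .$$ Re-optimize from the current basis by the lexicographic primal simplex method: as long as some reduced cost is negative, choose any column $j$ with negative reduced cost to enter the basis; the row $l$ of the leaving variable minimizes $h_{l\cdot}\vec\epsilon/(A_\beta^{-1}A_j)_l$ over all $l$ with $(A_\beta^{-1}A_j)_l>0$. (a) If there is no such $l$, the current lex-P is unbounded; stop and return the corresponding ray. (b) Otherwise, when all reduced costs are nonnegative, go to step 1. **Theorem.** Assume that the feasible region $\{y\in\mathbb{R}^m: y'A\le c'\}$ of lex-D is nonempty and bounded. Then lex-P has an optimal basis, and from every optimal starting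 basis, and for all choices of the entering columns, Algorithm 1 terminates after finitely many iterations (and finitely many pivots in total). It stops either - in step 1, and then the returned $\bar y$ is an optimal solution of $\text{lex-D}_{\mathcal I}$; or - in step 2(a), and then $\text{lex-D}_{\mathcal I}$ is infeasible and the algorithm has produced a certificate of this: a system $y'\tilde A\le\tilde c'$ obtained from $y'A\le c'$ by successively appending inequalities, each valid for the points satisfying the preceding inequalities together with $y_i\le k$ or $y_i\ge k+1$ (for some $i\in\mathcal I$, $k\in\mathbb{Z}$), and a vector $x\ge\mathbf 0$ with $\tilde A x=\mathbf 0$ and $\tilde c'x<0$. -/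

import Mathlib

noncomputable section

namespace LexColGen

open Matrix

/-- The data of a linear program in dual form with `m` variables `y` and `n` constraints
`y' A ≤ c'` (equivalently, of the standard-form primal problem with columns `A` and costs `c`). -/
structure DualLP (m : ℕ) where
  /-- number of constraints of the dual form = number of columns of the primal form -/
  n : ℕ
  A : Matrix (Fin m) (Fin n) ℝ
  c : Fin n → ℝ

namespace DualLP

variable {m : ℕ}

/-- The linear program with the integer data `A`, `c`. -/
def ofInt {n : ℕ} (A : Matrix (Fin m) (Fin n) ℤ) (c : Fin n → ℤ) : DualLP m where
  n := n
  A := A.map fun a => (a : ℝ)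
  c := fun j => (c j : ℝ)

/-- The feasible region `{y : y' A ≤ c'}` of the continuous relaxation lex-D. -/
def feasible (L : DualLP m) : Set (Fin m → ℝ) := {y | y ᵥ* L.A ≤ L.c}

/-- The feasible region of lex-D_I: `y' A ≤ c'`, and `y i` is an integer for `i ∈ I`. -/
def mixedFeasible (L : DualLP m) (I : Finset (Fin m)) : Set (Fin m → ℝ) :=
  {y | y ∈ L.feasible ∧ ∀ i ∈ I, ∃ z : ℤ, y i = z}

/-- `y` is an optimal solution of lex-D_I.  The objective `∑ k, y k * ε ^ k` (`k = 0, …, m - 1`),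
with `ε` a positive infinitesimal indeterminate, is compared coefficient by coefficient starting
with the constant one, that is, by the lexicographic order of the vectors `y`. -/
def IsMixedOptimal (L : DualLP m) (I : Finset (Fin m)) (y : Fin m → ℝ) : Prop :=
  y ∈ L.mixedFeasible I ∧ ∀ w ∈ L.mixedFeasible I, toLex w ≤ toLex y

/-- Append the column `a` with cost `γ` (the inequality `y' a ≤ γ` in dual form). -/
def appendColumn (L : DualLP m) (a : Fin m → ℝ) (γ : ℝ) : DualLP m where
  n := L.n + 1
  A := Matrix.of fun k => Fin.snoc (α := fun _ => ℝ) (L.A k) (a k)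
  c := Fin.snoc (α := fun _ => ℝ) L.c γ

/-- `L` arises from `L₀` by successively appending inequalities `y' a ≤ γ`, each of which holds on
both parts `y i ≤ k` and `y i ≥ k + 1` (for some `i ∈ I` and some integer `k`) of the feasible
region of the system constructed so far. -/
inductive SplitDerivable (I : Finset (Fin m)) (L₀ : DualLP m) : DualLP m → Prop
  | base : SplitDerivable I L₀ L₀
  | append (L : DualLP m) (i : Fin m) (k : ℤ) (a : Fin m → ℝ) (γ : ℝ) :
      SplitDerivable I L₀ L → i ∈ I →
      (∀ y ∈ L.feasible, y i ≤ k → y ⬝ᵥ a ≤ γ) →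
      (∀ y ∈ L.feasible, (k : ℝ) + 1 ≤ y i → y ⬝ᵥ a ≤ γ) →
      SplitDerivable I L₀ (L.appendColumn a γ)

/-- A certificate that lex-D_I is infeasible: a system `L` derived from `L₀` by disjunctive cuts on
the integer-constrained variables, and a Farkas multiplier `x` showing that `L` is infeasible
(at the same time a ray along which the primal problem of `L` is unbounded). -/
structure IsInfeasibilityCertificate (L₀ : DualLP m) (I : Finset (Fin m)) (L : DualLP m)
    (x : Fin L.n → ℝ) : Prop where
  derivable : SplitDerivable I L₀ L
  nonneg : 0 ≤ x
  mulVec_eq_zero : L.A *ᵥ x = 0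
  cost_neg : L.c ⬝ᵥ x < 0

end DualLP

/-- A linear program with a choice of `m` columns `β 0, …, β (m - 1)`. -/
structure Tableau (m : ℕ) where
  lp : DualLP m
  β : Fin m → Fin lp.n

namespace Tableau

variable {m : ℕ}

/-- `A_β` -/
def basisMatrix (T : Tableau m) : Matrix (Fin m) (Fin m) ℝ := T.lp.A.submatrix id T.β

/-- `A_β⁻¹`; its rows are `h_{l·}` and its columns are `h_{·i}`. -/
def H (T : Tableau m) : Matrix (Fin m) (Fin m) ℝ := T.basisMatrix⁻¹

/-- `c_β` -/
def cβ (T : Tableau m) : Fin m → ℝ := fun l => T.lp.c (T.β l)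

/-- The dual basic solution `ȳ' = c_β' A_β⁻¹`. -/
def dual (T : Tableau m) : Fin m → ℝ := T.cβ ᵥ* T.H

/-- The reduced cost `c_j - ȳ' A_j` of column `j`. -/
def redCost (T : Tableau m) (j : Fin T.lp.n) : ℝ := T.lp.c j - T.dual ⬝ᵥ T.lp.A.col j

/-- The updated column `A_β⁻¹ A_j`. -/
def updCol (T : Tableau m) (j : Fin T.lp.n) : Fin m → ℝ := T.H *ᵥ T.lp.A.col j

/-- `β` is a basis. -/
def IsBasis (T : Tableau m) : Prop := IsUnit T.basisMatrix

/-- Feasibility of the basic solution of lex-P.  The `l`-th basic variable has the value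
`∑ k, H l k * ε ^ k`, which is nonnegative for the positive infinitesimal `ε` if and only if the
row `H l` is lexicographically nonnegative. -/
def PrimalFeasible (T : Tableau m) : Prop := ∀ l, toLex (0 : Fin m → ℝ) ≤ toLex (T.H l)

/-- All reduced costs are nonnegative. -/
def DualFeasible (T : Tableau m) : Prop := ∀ j, 0 ≤ T.redCost j

/-- `β` is an optimal basis of lex-P. -/
def IsOptimalBasis (T : Tableau m) : Prop := T.IsBasis ∧ T.PrimalFeasible ∧ T.DualFeasible

/-- The condition on `r` in the F-GMI column for index `i`:
`r` is an integer vector with `r ≥ -h_{·i}` and `r ≥ 0`. -/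
def kappa (T : Tableau m) (i : Fin m) : Set (Fin m → ℤ) :=
  {r | (∀ k, -T.H k i ≤ (r k : ℝ)) ∧ 0 ≤ r}

/-- The F-GMI column `A_β r - (ȳ_i - ⌊ȳ_i⌋ - 1) e_i`. -/
def fgmiColumn (T : Tableau m) (i : Fin m) (r : Fin m → ℤ) : Fin m → ℝ :=
  T.basisMatrix *ᵥ (fun k => (r k : ℝ)) -
    (T.dual i - (⌊T.dual i⌋ : ℝ) - 1) • (Pi.single i 1 : Fin m → ℝ)

/-- The F-GMI cost `c_β' r - (ȳ_i - ⌊ȳ_i⌋ - 1) ⌊ȳ_i⌋`. -/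
def fgmiCost (T : Tableau m) (i : Fin m) (r : Fin m → ℤ) : ℝ :=
  T.cβ ⬝ᵥ (fun k => (r k : ℝ)) - (T.dual i - (⌊T.dual i⌋ : ℝ) - 1) * (⌊T.dual i⌋ : ℝ)

/-- Append the F-GMI column as a new nonbasic column; the basis is unchanged. -/
def addFGMI (T : Tableau m) (i : Fin m) (r : Fin m → ℤ) : Tableau m where
  lp := T.lp.appendColumn (T.fgmiColumn i r) (T.fgmiCost i r)
  β := fun l => (T.β l).castSucc

/-- The ratio test for lex-P with entering column `j`: row `l` minimizes
`(h_{l·} ε⃗) / (A_β⁻¹ A_j)_l` over the rows with a positive denominator, where the numerators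
are polynomials in `ε` and hence compared lexicographically. -/
def IsLeavingRow (T : Tableau m) (j : Fin T.lp.n) (l : Fin m) : Prop :=
  0 < T.updCol j l ∧ ∀ k, 0 < T.updCol j k →
    toLex ((T.updCol j l)⁻¹ • T.H l) ≤ toLex ((T.updCol j k)⁻¹ • T.H k)

/-- Column `j` replaces the `l`-th basic column. -/
def pivot (T : Tableau m) (j : Fin T.lp.n) (l : Fin m) : Tableau m where
  lp := T.lp
  β := Function.update T.β l j

/-- The direction in which the nonbasic variable `j` increases at unit rate:
`x_j = 1`, `x_β = -A_β⁻¹ A_j`, all other components `0`. -/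
def ray (T : Tableau m) (j : Fin T.lp.n) : Fin T.lp.n → ℝ :=
  Pi.single j 1 - ∑ l, Pi.single (T.β l) (T.updCol j l)

end Tableau

/-- The configurations of the column-generation algorithm. -/
inductive Config (m : ℕ) : Type
  /-- step 1, with an optimal basis of the current lex-P -/
  | visit (T : Tableau m)
  /-- step 2, inside the primal simplex algorithm -/
  | solving (T : Tableau m)
  /-- stopped in step 1, with the output `y` -/
  | solved (y : Fin m → ℝ)
  /-- stopped in step 2(a): the current lex-P is unbounded along the ray `x` -/
  | unbounded (T : Tableau m) (x : Fin T.lp.n → ℝ)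

/-- One elementary step of the algorithm for the set `I` of integer-constrained variables.
Any column with negative reduced cost may enter in a simplex pivot. -/
inductive Step {m : ℕ} (I : Finset (Fin m)) : Config m → Config m → Prop
  | finish (T : Tableau m) :
      (∀ i ∈ I, ∃ z : ℤ, T.dual i = z) →
      Step I (.visit T) (.solved T.dual)
  | addColumn (T : Tableau m) (i : Fin m) (r : Fin m → ℤ) :
      IsLeast {k | k ∈ I ∧ ¬ ∃ z : ℤ, T.dual k = z} i →
      IsLeast (T.kappa i) r →
      Step I (.visit T) (.solving (T.addFGMI i r))
  | pivot (T : Tableau m) (j : Fin T.lp.n) (l : Fin m) :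
      T.redCost j < 0 → T.IsLeavingRow j l →
      Step I (.solving T) (.solving (T.pivot j l))
  | detectUnbounded (T : Tableau m) (j : Fin T.lp.n) :
      T.redCost j < 0 → (∀ l, T.updCol j l ≤ 0) →
      Step I (.solving T) (.unbounded T (T.ray j))
  | reoptimized (T : Tableau m) :
      T.DualFeasible →
      Step I (.solving T) (.visit T)

end LexColGen

end

/-!
The algorithm is a lexicographic form of Gomory's method of integer forms.

*Simplex phases.* For a basis `β` with dual basic solution `ȳ`, every `y` satisfies
`ȳ - y = ∑ l, s l • H l`, where `s` are the slacks at `y` of the basic constraints and `H l` are the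
rows of `A_β⁻¹`. If these rows are lexicographically nonnegative, `ȳ` is therefore the lexicographic
maximum of the feasible region as soon as it is feasible (`Tableau.toLex_le_toLex_dual`). A pivot
subtracts a positive multiple of a nonzero row from `ȳ` (`Tableau.toLex_dual_pivot_lt`), so no basis
is repeated and each simplex phase is finite. An entering column without leaving row yields
a Farkas certificate (`Tableau.mulVec_ray`, `Tableau.ray_nonneg`, `Tableau.cost_ray`). Starting from
the artificial columns of the big-`M` method, the same facts provide an optimal basis of the initial
program (`DualLP.exists_isOptimalBasis`): by boundedness, `M` can be chosen so large that no bound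
`y k ≤ M` is tight.

*Cuts.* The F-GMI inequality at `i` is valid on both sides of the split `y i ≤ ⌊ȳ i⌋` or
`y i ≥ ⌊ȳ i⌋ + 1` (`Tableau.fgmi_of_le`, `Tableau.fgmi_of_ge`), so no mixed-integer point is lost.
Since `r` is minimal, it vanishes at every `l` with `H l i ≥ 0`, and on the points that agree with
`ȳ` before `i` the cut reduces to `y i ≤ ⌊ȳ i⌋` (`Tableau.apply_le_floor`). Every other remaining
point drops strictly below `ȳ` in a coordinate before `i`, where `ȳ` is an integer because `I` is
an initial segment. In both cases the vector with the entries `⌊y k⌋ + ⌈y k⌉` decreases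
lexicographically (`toLex_potential_lt`). As the feasible region is bounded, these are, up to
a shift, vectors of natural numbers, so only finitely many cuts are generated (`acc_visit`).
-/

namespace LexColGen

open Matrix

/-! ### The lexicographic order on real vectors -/

section Lex

variable {m : ℕ}

theorem toLex_smul_nonneg {v : Fin m → ℝ} {a : ℝ} (ha : 0 ≤ a)
    (hv : toLex (0 : Fin m → ℝ) ≤ toLex v) : toLex (0 : Fin m → ℝ) ≤ toLex (a • v) := by
  rcases ha.eq_or_lt with rfl | ha
  · simp
  rcases hv.eq_or_lt with h | ⟨i, hi, hlt⟩
  · rw [← toLex.injective h, smul_zero]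
  · refine le_of_lt ⟨i, fun j hj => ?_, ?_⟩
    · have : 0 = v j := hi j hj
      simp [← this]
    · have : 0 < v i := hlt
      simpa using mul_pos ha this

theorem toLex_sum_nonneg {ι : Type*} (s : Finset ι) (v : ι → Fin m → ℝ)
    (hv : ∀ l ∈ s, toLex (0 : Fin m → ℝ) ≤ toLex (v l)) :
    toLex (0 : Fin m → ℝ) ≤ toLex (∑ l ∈ s, v l) :=
  Finset.sum_induction v (fun w => toLex (0 : Fin m → ℝ) ≤ toLex w)
    (fun _ _ ha hb => add_nonneg (α := Lex (Fin m → ℝ)) ha hb) le_rfl hv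

theorem toLex_sub_nonneg {v w : Fin m → ℝ} :
    toLex (0 : Fin m → ℝ) ≤ toLex (w - v) ↔ toLex v ≤ toLex w :=
  sub_nonneg (α := Lex (Fin m → ℝ))

/-- If the first nonzero entry of a lexicographically nonnegative vector `a` lies before `i`, then
every vector that is lexicographically at least `a` has a nonzero entry before `i`. -/
theorem eq_zero_of_toLex_le {a d : Fin m → ℝ} {i : Fin m}
    (ha : toLex (0 : Fin m → ℝ) ≤ toLex a) (had : toLex a ≤ toLex d) (hd : ∀ j < i, d j = 0) :
    ∀ j < i, a j = 0 := by
  intro j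
  induction j using WellFoundedLT.induction with
  | ind j ih =>
    intro hj
    have h0 : ∀ k < j, a k = 0 := fun k hk => ih k hk (hk.trans hj)
    refine le_antisymm ?_ ?_
    · rw [← hd j hj]
      exact Pi.apply_le_of_toLex had fun k hk => by rw [h0 k hk, hd k (hk.trans hj)]
    · exact Pi.apply_le_of_toLex ha fun k hk => (h0 k hk).symm

end Lex

/-! ### Feasible regions and derived systems -/

namespace DualLP

variable {m : ℕ} {L L₀ : DualLP m} {I : Finset (Fin m)}

theorem mem_feasible {y : Fin m → ℝ} : y ∈ L.feasible ↔ ∀ j, y ⬝ᵥ L.A.col j ≤ L.c j := Iff.rfl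

theorem col_appendColumn_castSucc (a : Fin m → ℝ) (γ : ℝ) (j : Fin L.n) :
    (L.appendColumn a γ).A.col j.castSucc = L.A.col j :=
  funext fun k => Fin.snoc_castSucc (α := fun _ => ℝ) (a k) (L.A k) j

theorem col_appendColumn_last (a : Fin m → ℝ) (γ : ℝ) :
    (L.appendColumn a γ).A.col (Fin.last L.n) = a :=
  funext fun k => Fin.snoc_last (α := fun _ => ℝ) (a k) (L.A k)

theorem c_appendColumn_castSucc (a : Fin m → ℝ) (γ : ℝ) (j : Fin L.n) :
    (L.appendColumn a γ).c j.castSucc = L.c j :=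
  Fin.snoc_castSucc (α := fun _ => ℝ) γ L.c j

theorem c_appendColumn_last (a : Fin m → ℝ) (γ : ℝ) :
    (L.appendColumn a γ).c (Fin.last L.n) = γ :=
  Fin.snoc_last (α := fun _ => ℝ) γ L.c

theorem mem_feasible_appendColumn {a : Fin m → ℝ} {γ : ℝ} {y : Fin m → ℝ} :
    y ∈ (L.appendColumn a γ).feasible ↔ y ∈ L.feasible ∧ y ⬝ᵥ a ≤ γ := by
  rw [mem_feasible, mem_feasible]
  refine (Fin.forall_fin_succ' (n := L.n)).trans (and_congr (forall_congr' fun j => ?_) ?_)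
  · rw [col_appendColumn_castSucc, c_appendColumn_castSucc]
  · rw [col_appendColumn_last, c_appendColumn_last]

theorem SplitDerivable.feasible_subset (h : SplitDerivable I L₀ L) : L.feasible ⊆ L₀.feasible := by
  induction h with
  | base => exact subset_rfl
  | append L i k a γ _ _ _ _ ih => exact fun y hy => ih (mem_feasible_appendColumn.1 hy).1

theorem SplitDerivable.mixedFeasible_subset (h : SplitDerivable I L₀ L) :
    L₀.mixedFeasible I ⊆ L.mixedFeasible I := by
  induction h with
  | base => exact subset_rfl
  | append L i k a γ _ hi hle hge ih =>
    intro y hy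
    obtain ⟨hL, hint⟩ := ih hy
    refine ⟨mem_feasible_appendColumn.2 ⟨hL, ?_⟩, hint⟩
    obtain ⟨z, hz⟩ := hint i hi
    rcases le_or_gt z k with hk | hk
    · exact hle y hL (by rw [hz]; exact_mod_cast hk)
    · exact hge y hL (by rw [hz]; exact_mod_cast hk)

/-- Farkas' lemma, easy direction. -/
theorem feasible_eq_empty {x : Fin L.n → ℝ} (hx : 0 ≤ x) (hA : L.A *ᵥ x = 0)
    (hc : L.c ⬝ᵥ x < 0) : L.feasible = ∅ := by
  refine Set.eq_empty_of_forall_notMem fun y hy => ?_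
  have h1 : (y ᵥ* L.A) ⬝ᵥ x ≤ L.c ⬝ᵥ x := dotProduct_le_dotProduct_of_nonneg_right hy hx
  rw [← dotProduct_mulVec, hA, dotProduct_zero] at h1
  exact h1.not_gt hc

theorem IsInfeasibilityCertificate.mixedFeasible_eq_empty {x : Fin L.n → ℝ}
    (h : L₀.IsInfeasibilityCertificate I L x) : L₀.mixedFeasible I = ∅ := by
  refine Set.subset_eq_empty h.derivable.mixedFeasible_subset
    (Set.subset_eq_empty (fun y hy => hy.1)
      (feasible_eq_empty h.nonneg h.mulVec_eq_zero h.cost_neg))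

end DualLP

/-! ### Basic solutions -/

namespace Tableau

variable {m : ℕ} {T : Tableau m}

theorem H_mul_basisMatrix (hB : T.IsBasis) : T.H * T.basisMatrix = 1 :=
  nonsing_inv_mul _ ((isUnit_iff_isUnit_det _).1 hB)

theorem basisMatrix_mul_H (hB : T.IsBasis) : T.basisMatrix * T.H = 1 :=
  mul_nonsing_inv _ ((isUnit_iff_isUnit_det _).1 hB)

theorem dual_dotProduct_col_basis (hB : T.IsBasis) (l : Fin m) :
    T.dual ⬝ᵥ T.lp.A.col (T.β l) = T.lp.c (T.β l) := by
  have h : T.dual ᵥ* T.basisMatrix = T.cβ := by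
    rw [dual, vecMul_vecMul, H_mul_basisMatrix hB, vecMul_one]
  exact congrFun h l

theorem eq_dual (hB : T.IsBasis) {y : Fin m → ℝ}
    (hy : ∀ l, y ⬝ᵥ T.lp.A.col (T.β l) = T.lp.c (T.β l)) : T.dual = y := by
  have h : y ᵥ* T.basisMatrix = T.cβ := funext hy
  rw [dual, ← h, vecMul_vecMul, basisMatrix_mul_H hB, vecMul_one]

theorem H_row_ne_zero (hB : T.IsBasis) (l : Fin m) : T.H l ≠ 0 := by
  intro h
  have := congrFun (congrFun (H_mul_basisMatrix hB) l) l
  rw [mul_apply_eq_vecMul, h, zero_vecMul] at this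
  simp at this

theorem H_dotProduct_col_basis (hB : T.IsBasis) (k l : Fin m) :
    T.H k ⬝ᵥ T.lp.A.col (T.β l) = if k = l then 1 else 0 := by
  have := congrFun (congrFun (H_mul_basisMatrix hB) k) l
  rw [one_apply] at this
  exact this

theorem H_dotProduct_col (k : Fin m) (j : Fin T.lp.n) :
    T.H k ⬝ᵥ T.lp.A.col j = T.updCol j k := rfl

theorem DualFeasible.dual_mem_feasible (h : T.DualFeasible) : T.dual ∈ T.lp.feasible :=
  DualLP.mem_feasible.2 fun j => sub_nonneg.1 (h j)

/-- The slacks of the basic constraints at `y` are the coordinates of `ȳ - y` in the rows of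
`A_β⁻¹`. -/
theorem dual_sub_eq_sum (hB : T.IsBasis) (y : Fin m → ℝ) :
    T.dual - y = ∑ l, (T.lp.c (T.β l) - y ⬝ᵥ T.lp.A.col (T.β l)) • T.H l := by
  have h : y = (y ᵥ* T.basisMatrix) ᵥ* T.H := by
    rw [vecMul_vecMul, basisMatrix_mul_H hB, vecMul_one]
  have h2 : T.dual - y = (T.cβ - y ᵥ* T.basisMatrix) ᵥ* T.H := by
    rw [sub_vecMul, ← h, dual]
  rw [h2, vecMul_eq_sum]
  rfl

/-- Weak duality: the dual basic solution of a primal feasible basis is a lexicographic upper bound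
on the feasible region. -/
theorem toLex_le_toLex_dual (hB : T.IsBasis) (hP : T.PrimalFeasible) {y : Fin m → ℝ}
    (hy : y ∈ T.lp.feasible) : toLex y ≤ toLex T.dual := by
  rw [← toLex_sub_nonneg, dual_sub_eq_sum hB]
  exact toLex_sum_nonneg _ _ fun l _ =>
    toLex_smul_nonneg (sub_nonneg.2 (DualLP.mem_feasible.1 hy _)) (hP l)

/-! ### Simplex pivots -/

/-- The inverse of the basis matrix after a pivot, by elimination in the updated column. -/
theorem pivot_inverse (hB : T.IsBasis) {j : Fin T.lp.n} {l : Fin m} (hl : T.updCol j l ≠ 0) :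
    (Matrix.of fun k => if k = l then (T.updCol j l)⁻¹ • T.H l
      else T.H k - (T.updCol j k / T.updCol j l) • T.H l) * (T.pivot j l).basisMatrix = 1 := by
  ext k q
  rw [one_apply]
  have hcol : (T.pivot j l).basisMatrix.col q =
      if q = l then T.lp.A.col j else T.lp.A.col (T.β q) := by
    split_ifs with h
    · subst h; ext; simp [basisMatrix, pivot]
    · ext; simp [basisMatrix, pivot, Function.update_of_ne h]
  change (if k = l then (T.updCol j l)⁻¹ • T.H l
      else T.H k - (T.updCol j k / T.updCol j l) • T.H l) ⬝ᵥ
      (T.pivot j l).basisMatrix.col q = _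
  rw [hcol]
  by_cases hk : k = l <;> by_cases hq : q = l
  · subst hk; subst hq
    simp [smul_dotProduct, H_dotProduct_col, hl]
  · subst hk
    simp [smul_dotProduct, hq, H_dotProduct_col_basis hB, Ne.symm hq]
  · subst hq
    simp [smul_dotProduct, sub_dotProduct, hk, H_dotProduct_col, hl]
  · simp [smul_dotProduct, sub_dotProduct, hk, hq, H_dotProduct_col_basis hB, Ne.symm hq]

theorem IsBasis.pivot (hB : T.IsBasis) {j : Fin T.lp.n} {l : Fin m} (hl : T.updCol j l ≠ 0) :
    (T.pivot j l).IsBasis :=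
  (isUnit_iff_isUnit_det _).2 (isUnit_det_of_left_inverse (pivot_inverse hB hl))

theorem H_pivot (hB : T.IsBasis) {j : Fin T.lp.n} {l : Fin m} (hl : T.updCol j l ≠ 0) (k : Fin m) :
    (T.pivot j l).H k = if k = l then (T.updCol j l)⁻¹ • T.H l
      else T.H k - (T.updCol j k / T.updCol j l) • T.H l := by
  rw [H, inv_eq_left_inv (pivot_inverse hB hl)]
  rfl

/-- The lexicographic ratio test preserves primal feasibility. -/
theorem PrimalFeasible.pivot (hB : T.IsBasis) (hP : T.PrimalFeasible) {j : Fin T.lp.n} {l : Fin m}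
    (hl : T.IsLeavingRow j l) : (T.pivot j l).PrimalFeasible := by
  obtain ⟨hpos, hmin⟩ := hl
  intro k
  rw [H_pivot hB hpos.ne']
  split_ifs with hk
  · exact toLex_smul_nonneg (inv_nonneg.2 hpos.le) (hP l)
  · rcases le_or_gt (T.updCol j k) 0 with hu | hu
    · rw [sub_eq_add_neg, ← neg_smul]
      exact add_nonneg (α := Lex (Fin m → ℝ)) (hP k) (toLex_smul_nonneg
        (neg_nonneg.2 (div_nonpos_of_nonpos_of_nonneg hu hpos.le)) (hP l))
    · have h := toLex_smul_nonneg hu.le (toLex_sub_nonneg.2 (hmin k hu))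
      rwa [smul_sub, smul_smul, smul_smul, mul_inv_cancel₀ hu.ne', one_smul, ← div_eq_mul_inv] at h

theorem dual_pivot (hB : T.IsBasis) {j : Fin T.lp.n} {l : Fin m} (hl : T.updCol j l ≠ 0) :
    (T.pivot j l).dual = T.dual + (T.redCost j / T.updCol j l) • T.H l := by
  refine eq_dual (hB.pivot hl) fun q => ?_
  change (_ : Fin m → ℝ) ⬝ᵥ T.lp.A.col (Function.update T.β l j q) =
    T.lp.c (Function.update T.β l j q)
  rw [add_dotProduct, smul_dotProduct]
  by_cases hq : q = l
  · subst hq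
    rw [Function.update_self, H_dotProduct_col, smul_eq_mul, div_mul_cancel₀ _ hl, redCost]
    ring
  · rw [Function.update_of_ne hq, H_dotProduct_col_basis hB, dual_dotProduct_col_basis hB,
      if_neg (Ne.symm hq), smul_zero, add_zero]

/-- The objective value `ȳ' ε⃗` of lex-P strictly decreases in every pivot, since no row of `A_β⁻¹`
vanishes: lexicographic perturbation excludes degeneracy. -/
theorem toLex_dual_pivot_lt (hB : T.IsBasis) (hP : T.PrimalFeasible) {j : Fin T.lp.n} {l : Fin m}
    (hj : T.redCost j < 0) (hl : T.IsLeavingRow j l) :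
    toLex (T.pivot j l).dual < toLex T.dual := by
  have hu := hl.1
  have hq : T.redCost j / T.updCol j l < 0 := div_neg_of_neg_of_pos hj hu
  refine lt_of_le_of_ne ?_ fun h => ?_
  · rw [← toLex_sub_nonneg, dual_pivot hB hu.ne', sub_add_cancel_left, ← neg_smul]
    exact toLex_smul_nonneg (neg_nonneg.2 hq.le) (hP l)
  · have h' := toLex.injective h
    rw [dual_pivot hB hu.ne', add_eq_left, smul_eq_zero] at h'
    exact h'.elim hq.ne (H_row_ne_zero hB l)

theorem exists_isLeavingRow {j : Fin T.lp.n} (h : ¬ ∀ l, T.updCol j l ≤ 0) :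
    ∃ l, T.IsLeavingRow j l := by
  push Not at h
  obtain ⟨l₀, h₀⟩ := h
  obtain ⟨l, hl, hmin⟩ := Finset.exists_min_image (Finset.univ.filter fun l => 0 < T.updCol j l)
    (fun l => toLex ((T.updCol j l)⁻¹ • T.H l)) ⟨l₀, by simpa using h₀⟩
  exact ⟨l, by simpa using hl, fun k hk => hmin k (by simpa using hk)⟩

/-- Well-founded induction along the pivots of the simplex algorithm: there are only finitely many
bases of a fixed linear program, and the dual basic solution strictly decreases. -/
theorem pivot_induction (L : DualLP m) (P : (Fin m → Fin L.n) → Prop)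
    (ih : ∀ β, (∀ β', toLex (⟨L, β'⟩ : Tableau m).dual < toLex (⟨L, β⟩ : Tableau m).dual → P β') →
      P β) (β : Fin m → Fin L.n) : P β := by
  have wf : WellFounded fun β' β : Fin m → Fin L.n =>
      toLex (⟨L, β'⟩ : Tableau m).dual < toLex (⟨L, β⟩ : Tableau m).dual :=
    haveI : IsTrans (Fin m → Fin L.n) fun β' β =>
      toLex (⟨L, β'⟩ : Tableau m).dual < toLex (⟨L, β⟩ : Tableau m).dual :=
      ⟨fun _ _ _ => lt_trans⟩
    haveI : Std.Irrefl fun β' β : Fin m → Fin L.n =>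
      toLex (⟨L, β'⟩ : Tableau m).dual < toLex (⟨L, β⟩ : Tableau m).dual := ⟨fun _ => lt_irrefl _⟩
    Finite.wellFounded_of_trans_of_irrefl _
  exact wf.induction β ih

theorem mulVec_ray (hB : T.IsBasis) (j : Fin T.lp.n) : T.lp.A *ᵥ T.ray j = 0 := by
  have h : T.basisMatrix *ᵥ T.updCol j = T.lp.A.col j := by
    rw [updCol, mulVec_mulVec, basisMatrix_mul_H hB, one_mulVec]
  rw [ray, mulVec_sub, mulVec_single_one, ← h, sub_eq_zero]
  ext k
  change ∑ l, T.lp.A k (T.β l) * T.updCol j l = T.lp.A k ⬝ᵥ _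
  simp_rw [dotProduct_sum, dotProduct_single]

theorem ray_nonneg {j : Fin T.lp.n} (h : ∀ l, T.updCol j l ≤ 0) : 0 ≤ T.ray j := by
  rw [ray, sub_eq_add_neg, ← Finset.sum_neg_distrib]
  refine add_nonneg (Pi.single_nonneg.2 zero_le_one) (Finset.sum_nonneg fun l _ => ?_)
  rw [← Pi.single_neg]
  exact Pi.single_nonneg.2 (neg_nonneg.2 (h l))

theorem cost_ray (j : Fin T.lp.n) : T.lp.c ⬝ᵥ T.ray j = T.redCost j := by
  have h : T.dual ⬝ᵥ T.lp.A.col j = T.cβ ⬝ᵥ T.updCol j := by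
    rw [dual, updCol, dotProduct_mulVec]
  rw [ray, dotProduct_sub, dotProduct_sum, redCost, h, dotProduct_single_one]
  simp_rw [dotProduct_single]
  rfl

/-- From a primal feasible basis of a linear program with a feasible dual, the simplex algorithm
reaches an optimal basis. -/
theorem exists_isOptimalBasis {L : DualLP m} (hL : L.feasible.Nonempty) (β : Fin m → Fin L.n)
    (hB : (⟨L, β⟩ : Tableau m).IsBasis) (hP : (⟨L, β⟩ : Tableau m).PrimalFeasible) :
    ∃ β', (⟨L, β'⟩ : Tableau m).IsOptimalBasis := by
  induction β using pivot_induction with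
  | ih β ih =>
    by_cases hD : (⟨L, β⟩ : Tableau m).DualFeasible
    · exact ⟨β, hB, hP, hD⟩
    · obtain ⟨j, hj⟩ := not_forall.1 hD
      rw [not_le] at hj
      by_cases hu : ∀ l, (⟨L, β⟩ : Tableau m).updCol j l ≤ 0
      · have := DualLP.feasible_eq_empty (ray_nonneg hu) (mulVec_ray hB j)
          (by rw [cost_ray]; exact hj)
        exact absurd this hL.ne_empty
      · obtain ⟨l, hl⟩ := exists_isLeavingRow hu
        exact ih (Function.update β l j) (toLex_dual_pivot_lt hB hP hj hl)
          (hB.pivot hl.1.ne') (hP.pivot hB hl)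

end Tableau

/-! ### An initial basis -/

namespace DualLP

variable {m : ℕ}

/-- The linear program `L` with the additional bounds `y k ≤ M`, that is, with `m` artificial unit
columns of cost `M` appended to the primal. -/
noncomputable def withArtificials (L : DualLP m) (M : ℝ) : DualLP m where
  n := L.n + m
  A := Matrix.of fun k => Fin.append (L.A k) (Pi.single k 1)
  c := Fin.append L.c fun _ => M

theorem col_withArtificials_castAdd (L : DualLP m) (M : ℝ) (j : Fin L.n) :
    (L.withArtificials M).A.col (Fin.castAdd m j) = L.A.col j :=
  funext fun k => Fin.append_left (L.A k) (Pi.single k 1) j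

theorem col_withArtificials_natAdd (L : DualLP m) (M : ℝ) (l : Fin m) :
    (L.withArtificials M).A.col (Fin.natAdd L.n l) = Pi.single l 1 :=
  funext fun k => (Fin.append_right (L.A k) (Pi.single k 1) l).trans (Pi.single_comm k 1 l)

theorem c_withArtificials_castAdd (L : DualLP m) (M : ℝ) (j : Fin L.n) :
    (L.withArtificials M).c (Fin.castAdd m j) = L.c j :=
  Fin.append_left L.c (fun _ : Fin m => M) j

theorem c_withArtificials_natAdd (L : DualLP m) (M : ℝ) (l : Fin m) :
    (L.withArtificials M).c (Fin.natAdd L.n l) = M :=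
  Fin.append_right L.c (fun _ : Fin m => M) l

theorem mem_feasible_withArtificials {L : DualLP m} {M : ℝ} {y : Fin m → ℝ} :
    y ∈ (L.withArtificials M).feasible ↔ y ∈ L.feasible ∧ ∀ l, y l ≤ M := by
  rw [mem_feasible, mem_feasible]
  refine (Fin.forall_fin_add (m := L.n) (n := m) _).trans
    (and_congr (forall_congr' fun j => ?_) (forall_congr' fun l => ?_))
  · rw [col_withArtificials_castAdd, c_withArtificials_castAdd]
  · rw [col_withArtificials_natAdd, c_withArtificials_natAdd, dotProduct_single_one]

/-- The big-`M` method: the artificial columns form a primal feasible basis, and no artificial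
column is left in an optimal basis when the bounds `y k ≤ M` are strict on the feasible region. -/
theorem exists_isOptimalBasis {L : DualLP m} (hL : L.feasible.Nonempty) {M : ℝ}
    (hM : ∀ y ∈ L.feasible, ∀ k, y k < M) :
    ∃ β, (⟨L, β⟩ : Tableau m).IsOptimalBasis := by
  have hI : (⟨L.withArtificials M, Fin.natAdd L.n⟩ : Tableau m).basisMatrix = 1 := by
    ext k l
    exact (congrFun (col_withArtificials_natAdd L M l) k).trans (by
      rw [one_apply, Pi.single_apply])
  have hB : (⟨L.withArtificials M, Fin.natAdd L.n⟩ : Tableau m).IsBasis := by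
    rw [Tableau.IsBasis, hI]
    exact isUnit_one
  have hP : (⟨L.withArtificials M, Fin.natAdd L.n⟩ : Tableau m).PrimalFeasible := by
    intro l
    rw [Tableau.H, hI, inv_one]
    refine Pi.toLex_monotone fun k => ?_
    rw [one_apply]
    split_ifs <;> simp
  obtain ⟨y, hy⟩ := hL
  obtain ⟨β, hβB, hβP, hβD⟩ := Tableau.exists_isOptimalBasis
    ⟨y, mem_feasible_withArtificials.2 ⟨hy, fun k => (hM y hy k).le⟩⟩ _ hB hP
  have hd := (mem_feasible_withArtificials.1 hβD.dual_mem_feasible).1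
  -- An artificial basic column `k` would force the dual basic solution to satisfy `y k = M`.
  have hreal : ∀ l, ∃ j, Fin.castAdd m j = β l := by
    intro l
    have h := Tableau.dual_dotProduct_col_basis hβB l
    change _ ⬝ᵥ (L.withArtificials M).A.col (β l) = (L.withArtificials M).c (β l) at h
    revert h
    refine Fin.addCases (m := L.n) (n := m) (motive := fun q =>
      _ ⬝ᵥ (L.withArtificials M).A.col q = (L.withArtificials M).c q →
        ∃ j, Fin.castAdd m j = q) (fun j _ => ⟨j, rfl⟩) (fun k h => ?_) (β l)
    rw [col_withArtificials_natAdd, c_withArtificials_natAdd, dotProduct_single_one] at h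
    exact absurd h (hM _ hd k).ne
  choose γ hγ using hreal
  obtain rfl : (fun l => Fin.castAdd m (γ l)) = β := funext hγ
  have hbm : (⟨L, γ⟩ : Tableau m).basisMatrix = (⟨L.withArtificials M,
      fun l => Fin.castAdd m (γ l)⟩ : Tableau m).basisMatrix := by
    ext k l
    exact (congrFun (col_withArtificials_castAdd L M (γ l)) k).symm
  have hH : (⟨L, γ⟩ : Tableau m).H = (⟨L.withArtificials M,
      fun l => Fin.castAdd m (γ l)⟩ : Tableau m).H := congrArg (·⁻¹) hbm
  have hγB : (⟨L, γ⟩ : Tableau m).IsBasis := by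
    rw [Tableau.IsBasis, hbm]
    exact hβB
  refine ⟨γ, hγB, fun l => ?_, fun j => ?_⟩
  · rw [hH]
    exact hβP l
  · have hdual : (⟨L, γ⟩ : Tableau m).dual = _ := Tableau.eq_dual hγB fun l => by
      have h := Tableau.dual_dotProduct_col_basis hβB l
      change _ ⬝ᵥ (L.withArtificials M).A.col (Fin.castAdd m (γ l)) =
        (L.withArtificials M).c (Fin.castAdd m (γ l)) at h
      rwa [col_withArtificials_castAdd, c_withArtificials_castAdd] at h
    rw [Tableau.redCost, hdual]
    exact sub_nonneg.2 (mem_feasible.1 hd j)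

end DualLP

/-! ### The F-GMI cut -/

namespace Tableau

variable {m : ℕ} {T : Tableau m}

theorem exists_isLeast_kappa (T : Tableau m) (i : Fin m) : ∃ r, IsLeast (T.kappa i) r := by
  refine ⟨fun k => max ⌈-T.H k i⌉ 0, ⟨fun k => ?_, fun k => le_max_right _ _⟩, fun r hr k => ?_⟩
  · exact (Int.le_ceil _).trans (by exact_mod_cast le_max_left _ _)
  · exact max_le (Int.ceil_le.2 (hr.1 k)) (hr.2 k)

theorem eq_zero_of_isLeast_kappa {i l : Fin m} {r : Fin m → ℤ} (hr : IsLeast (T.kappa i) r)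
    (hl : 0 ≤ T.H l i) : r l = 0 := by
  refine le_antisymm ?_ (hr.1.2 l)
  have h : Function.update r l 0 ∈ T.kappa i := by
    refine ⟨fun k => ?_, fun k => ?_⟩ <;> by_cases hk : k = l
    · subst hk; simpa using hl
    · rw [Function.update_of_ne hk]; exact hr.1.1 k
    · subst hk; simp
    · rw [Function.update_of_ne hk]; exact hr.1.2 k
  simpa using hr.2 h l

theorem dotProduct_basisMatrix_mulVec (y v : Fin m → ℝ) :
    y ⬝ᵥ (T.basisMatrix *ᵥ v) =
      T.cβ ⬝ᵥ v - ∑ l, (T.lp.c (T.β l) - y ⬝ᵥ T.lp.A.col (T.β l)) * v l := by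
  rw [dotProduct_mulVec]
  simp only [dotProduct, sub_mul, Finset.sum_sub_distrib]
  change _ = ∑ l, T.lp.c (T.β l) * v l - (∑ l, T.lp.c (T.β l) * v l - _)
  rw [sub_sub_cancel]
  rfl

/-- The F-GMI inequality in terms of the slacks of the basic constraints. -/
theorem fgmi_iff (i : Fin m) (r : Fin m → ℤ) (y : Fin m → ℝ) :
    y ⬝ᵥ T.fgmiColumn i r ≤ T.fgmiCost i r ↔
      (1 - Int.fract (T.dual i)) * (y i - ⌊T.dual i⌋) ≤
        ∑ l, (T.lp.c (T.β l) - y ⬝ᵥ T.lp.A.col (T.β l)) * r l := by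
  rw [fgmiColumn, fgmiCost, dotProduct_sub, dotProduct_smul, dotProduct_single_one,
    dotProduct_basisMatrix_mulVec, Int.fract, smul_eq_mul]
  constructor <;> intro h <;> linarith

theorem fgmi_of_le {i : Fin m} {r : Fin m → ℤ} (hr : r ∈ T.kappa i) {y : Fin m → ℝ}
    (hy : y ∈ T.lp.feasible) (hi : y i ≤ ⌊T.dual i⌋) :
    y ⬝ᵥ T.fgmiColumn i r ≤ T.fgmiCost i r := by
  rw [fgmi_iff]
  refine (mul_nonpos_of_nonneg_of_nonpos (sub_nonneg.2 (Int.fract_lt_one _).le)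
    (sub_nonpos.2 hi)).trans (Finset.sum_nonneg fun l _ => mul_nonneg
      (sub_nonneg.2 (DualLP.mem_feasible.1 hy _)) (by exact_mod_cast hr.2 l))

/-- For `y i ≥ ⌊ȳ i⌋ + 1` the cut is a weakening of the combination of the basic constraints with
the multipliers `r + h_{·i} ≥ 0`. -/
theorem fgmi_of_ge (hB : T.IsBasis) {i : Fin m} {r : Fin m → ℤ} (hr : r ∈ T.kappa i)
    {y : Fin m → ℝ} (hy : y ∈ T.lp.feasible) (hi : (⌊T.dual i⌋ : ℝ) + 1 ≤ y i) :
    y ⬝ᵥ T.fgmiColumn i r ≤ T.fgmiCost i r := by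
  rw [fgmi_iff]
  -- `r l ≥ -H l i`, and `∑ l, s l * H l i = ȳ i - y i` for the slacks `s`
  have h1 : y i - T.dual i ≤ ∑ l, (T.lp.c (T.β l) - y ⬝ᵥ T.lp.A.col (T.β l)) * r l := by
    have h := congrFun (dual_sub_eq_sum hB y) i
    rw [Finset.sum_apply, Pi.sub_apply] at h
    rw [← neg_sub, h, ← Finset.sum_neg_distrib]
    refine Finset.sum_le_sum fun l _ => ?_
    rw [Pi.smul_apply, smul_eq_mul, ← mul_neg]
    exact mul_le_mul_of_nonneg_left (hr.1 l) (sub_nonneg.2 (DualLP.mem_feasible.1 hy _))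
  have h2 := mul_nonneg (Int.fract_nonneg (T.dual i)) (sub_nonneg.2 hi)
  have h3 := Int.floor_add_fract (T.dual i)
  refine le_trans ?_ h1
  linarith

/-- The F-GMI cut at `i`, for the minimal `r`, is as strong as the bound `y i ≤ ⌊ȳ i⌋` on the points
`y` that agree with `ȳ` before `i`: a basic constraint that is not tight at `y` has a row of
`A_β⁻¹` that vanishes before `i`, so its `i`-th entry is nonnegative and `r` vanishes there. -/
theorem apply_le_floor (hB : T.IsBasis) (hP : T.PrimalFeasible) {i : Fin m} {r : Fin m → ℤ}
    (hr : IsLeast (T.kappa i) r) {y : Fin m → ℝ} (hy : y ∈ T.lp.feasible)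
    (hcut : y ⬝ᵥ T.fgmiColumn i r ≤ T.fgmiCost i r) (hpre : ∀ j < i, y j = T.dual j) :
    y i ≤ ⌊T.dual i⌋ := by
  have hs : ∀ l, 0 ≤ T.lp.c (T.β l) - y ⬝ᵥ T.lp.A.col (T.β l) := fun l =>
    sub_nonneg.2 (DualLP.mem_feasible.1 hy _)
  have hzero : ∑ l, (T.lp.c (T.β l) - y ⬝ᵥ T.lp.A.col (T.β l)) * (r l : ℝ) = 0 := by
    refine Finset.sum_eq_zero fun l _ => ?_
    rcases (hs l).eq_or_lt with h0 | hpos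
    · rw [← h0, zero_mul]
    have hle : toLex ((T.lp.c (T.β l) - y ⬝ᵥ T.lp.A.col (T.β l)) • T.H l) ≤
        toLex (T.dual - y) := by
      rw [dual_sub_eq_sum hB, ← Finset.add_sum_erase _ _ (Finset.mem_univ l), ← toLex_sub_nonneg,
        add_sub_cancel_left]
      exact toLex_sum_nonneg _ _ fun k _ => toLex_smul_nonneg (hs k) (hP k)
    have hrow : ∀ j < i, T.H l j = 0 := fun j hj => by
      have h := eq_zero_of_toLex_le (toLex_smul_nonneg (hs l) (hP l)) hle
        (fun k hk => by rw [Pi.sub_apply, hpre k hk, sub_self]) j hj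
      exact (mul_eq_zero.1 h).resolve_left hpos.ne'
    rw [eq_zero_of_isLeast_kappa hr (Pi.apply_le_of_toLex (hP l) fun j hj => (hrow j hj).symm),
      Int.cast_zero, mul_zero]
  rw [fgmi_iff, hzero] at hcut
  exact sub_nonpos.1 (nonpos_of_mul_nonpos_right hcut (sub_pos.2 (Int.fract_lt_one _)))

theorem basisMatrix_addFGMI (T : Tableau m) (i : Fin m) (r : Fin m → ℤ) :
    (T.addFGMI i r).basisMatrix = T.basisMatrix := by
  ext k l
  exact congrFun (DualLP.col_appendColumn_castSucc _ _ (T.β l)) k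

theorem IsBasis.addFGMI (hB : T.IsBasis) (i : Fin m) (r : Fin m → ℤ) :
    (T.addFGMI i r).IsBasis := by
  rw [IsBasis, basisMatrix_addFGMI]
  exact hB

theorem PrimalFeasible.addFGMI (hP : T.PrimalFeasible) (i : Fin m) (r : Fin m → ℤ) :
    (T.addFGMI i r).PrimalFeasible := by
  intro l
  rw [H, basisMatrix_addFGMI]
  exact hP l

end Tableau

/-! ### Termination and correctness of the algorithm -/

section Potential

variable {m : ℕ}

/-- The potential `⌊y k⌋ + ⌈y k⌉`, shifted by `2 N` so that it is a natural number when `y k ≥ -N`.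
It is monotone in `y k`; it drops whenever `y k` drops below an integer that it attained,
and whenever a fractional `y k` drops to its floor. -/
noncomputable def potential (N : ℤ) (y : Fin m → ℝ) (k : Fin m) : ℕ :=
  (⌊y k⌋ + N + (⌈y k⌉ + N)).toNat

theorem potential_lt {N : ℤ} {y w : Fin m → ℝ} {k : Fin m} (hw : -(N : ℝ) ≤ w k)
    (h : ⌊w k⌋ + ⌈w k⌉ < ⌊y k⌋ + ⌈y k⌉) : potential N w k < potential N y k := by
  have h1 : -N ≤ ⌊w k⌋ := Int.le_floor.2 (by exact_mod_cast hw)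
  have h2 := Int.floor_le_ceil (w k)
  unfold potential
  omega

end Potential

section Run

variable {m : ℕ} {I : Finset (Fin m)} {L₀ : DualLP m}

/-- The potential decreases lexicographically from one visit of step 1 to the next. -/
theorem toLex_potential_lt {N : ℤ} {T : Tableau m} (hB : T.IsBasis) (hP : T.PrimalFeasible)
    (hI : ∀ i ∈ I, ∀ j < i, j ∈ I) {i : Fin m} {r : Fin m → ℤ}
    (hi : IsLeast {k | k ∈ I ∧ ¬ ∃ z : ℤ, T.dual k = z} i) (hr : IsLeast (T.kappa i) r)
    {y : Fin m → ℝ} (hy : y ∈ (T.addFGMI i r).lp.feasible) (hN : ∀ k, -(N : ℝ) ≤ y k) :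
    toLex (potential N y) < toLex (potential N T.dual) := by
  obtain ⟨hyT, hcut⟩ := DualLP.mem_feasible_appendColumn.1 hy
  have hint : ∀ j < i, ∃ z : ℤ, T.dual j = z := fun j hj => by
    by_contra h
    exact (hi.2 ⟨hI i hi.1.1 j hj, h⟩).not_gt hj
  by_cases hpre : ∀ j < i, y j = T.dual j
  · -- the cut acts as `y i ≤ ⌊ȳ i⌋` at the fractional `ȳ i`
    refine ⟨i, fun j hj => ?_, potential_lt (hN i) ?_⟩
    · simp [potential, hpre j hj]
    · have h := Tableau.apply_le_floor hB hP hr hyT hcut hpre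
      have h1 : ⌈y i⌉ ≤ ⌊T.dual i⌋ := Int.ceil_le.2 h
      have h2 := Int.floor_le_ceil (y i)
      have h3 : ⌊T.dual i⌋ < ⌈T.dual i⌉ := by
        refine (Int.floor_le_ceil _).lt_of_ne fun he => hi.1.2 ⟨⌊T.dual i⌋, ?_⟩
        exact le_antisymm (by rw [he]; exact Int.le_ceil _) (Int.floor_le _)
      omega
  · rcases (Tableau.toLex_le_toLex_dual hB hP hyT).eq_or_lt with he | ⟨k, hk, hlt⟩
    · exact absurd (fun j _ => congrFun (toLex.injective he) j) hpre
    -- `y` falls below `ȳ` in a coordinate `k < i`, where `ȳ k` is an integer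
    have hki : k < i := by
      by_contra h
      exact hpre fun j hj => hk j (hj.trans_le (not_lt.1 h))
    refine ⟨k, fun j hj => ?_, potential_lt (hN k) ?_⟩
    · have : y j = T.dual j := hk j hj
      simp [potential, this]
    · obtain ⟨z, hz⟩ := hint k hki
      have hlt' : y k < z := hz ▸ hlt
      have h1 : ⌊y k⌋ < z := Int.floor_lt.2 hlt'
      have h2 : ⌈y k⌉ ≤ z := Int.ceil_le.2 hlt'.le
      rw [hz, Int.floor_intCast, Int.ceil_intCast]
      omega

/-- The invariant of the algorithm, including the correctness of its two possible outputs. -/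
def Config.Valid (L₀ : DualLP m) (I : Finset (Fin m)) : Config m → Prop
  | .visit T => L₀.SplitDerivable I T.lp ∧ T.IsOptimalBasis
  | .solving T => L₀.SplitDerivable I T.lp ∧ T.IsBasis ∧ T.PrimalFeasible
  | .solved y => L₀.IsMixedOptimal I y
  | .unbounded T x => L₀.IsInfeasibilityCertificate I T.lp x ∧ L₀.mixedFeasible I = ∅

theorem Tableau.splitDerivable_addFGMI {T : Tableau m} (hB : T.IsBasis)
    (hd : L₀.SplitDerivable I T.lp) {i : Fin m} (hi : i ∈ I) {r : Fin m → ℤ}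
    (hr : r ∈ T.kappa i) : L₀.SplitDerivable I (T.addFGMI i r).lp :=
  .append T.lp i ⌊T.dual i⌋ _ _ hd hi (fun _ hy h => fgmi_of_le hr hy h)
    (fun _ hy h => fgmi_of_ge hB hr hy h)

theorem Config.Valid.step {C C' : Config m} (hC : C.Valid L₀ I) (h : Step I C C') :
    C'.Valid L₀ I := by
  cases h with
  | finish T hint =>
    obtain ⟨hd, hB, hP, hD⟩ := hC
    exact ⟨⟨hd.feasible_subset hD.dual_mem_feasible, hint⟩, fun w hw =>
      Tableau.toLex_le_toLex_dual hB hP (hd.mixedFeasible_subset hw).1⟩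
  | addColumn T i r hi hr =>
    obtain ⟨hd, hB, hP, -⟩ := hC
    exact ⟨Tableau.splitDerivable_addFGMI hB hd hi.1.1 hr.1, hB.addFGMI i r, hP.addFGMI i r⟩
  | pivot T j l hj hl =>
    obtain ⟨hd, hB, hP⟩ := hC
    exact ⟨hd, hB.pivot hl.1.ne', hP.pivot hB hl⟩
  | detectUnbounded T j hj hu =>
    obtain ⟨hd, hB, hP⟩ := hC
    have hcert : L₀.IsInfeasibilityCertificate I T.lp (T.ray j) :=
      ⟨hd, Tableau.ray_nonneg hu, Tableau.mulVec_ray hB j, by rw [Tableau.cost_ray]; exact hj⟩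
    exact ⟨hcert, hcert.mixedFeasible_eq_empty⟩
  | reoptimized T hD =>
    obtain ⟨hd, hB, hP⟩ := hC
    exact ⟨hd, hB, hP, hD⟩

/-- The simplex phase: if the algorithm terminates from every optimal basis of a linear program,
then it terminates from every primal feasible basis of that program. -/
theorem acc_solving {L : DualLP m}
    (hvisit : ∀ β : Fin m → Fin L.n, (⟨L, β⟩ : Tableau m).IsOptimalBasis →
      Acc (flip (Step I)) (.visit ⟨L, β⟩)) (β : Fin m → Fin L.n)
    (hB : (⟨L, β⟩ : Tableau m).IsBasis) (hP : (⟨L, β⟩ : Tableau m).PrimalFeasible) :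
    Acc (flip (Step I)) (.solving ⟨L, β⟩) := by
  induction β using Tableau.pivot_induction with
  | ih β ih =>
    refine ⟨_, fun C h => ?_⟩
    cases h with
    | pivot T j l hj hl =>
      exact ih _ (Tableau.toLex_dual_pivot_lt hB hP hj hl) (hB.pivot hl.1.ne') (hP.pivot hB hl)
    | detectUnbounded T j hj hu => exact ⟨_, fun C h => nomatch h⟩
    | reoptimized T hD => exact hvisit β ⟨hB, hP, hD⟩

/-- Termination: nested well-founded induction, on the potential from visit to visit of step 1 and
on the dual basic solution within each simplex phase. -/
theorem acc_visit {N : ℤ} (hN : ∀ y ∈ L₀.feasible, ∀ k, -(N : ℝ) ≤ y k)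
    (hI : ∀ i ∈ I, ∀ j < i, j ∈ I) {T : Tableau m} (hT : (Config.visit T).Valid L₀ I) :
    Acc (flip (Step I)) (.visit T) := by
  induction h : toLex (potential N T.dual) using WellFoundedLT.induction generalizing T with
  | ind p ih =>
    subst h
    refine ⟨_, fun C h => ?_⟩
    have hC := hT.step h
    cases h with
    | finish T hint => exact ⟨_, fun C h => nomatch h⟩
    | addColumn T i r hi hr =>
      refine acc_solving (fun β hβ => ?_) _ hC.2.1 hC.2.2
      have hy := hβ.2.2.dual_mem_feasible
      exact ih _ (toLex_potential_lt hT.2.1 hT.2.2.1 hI hi hr hy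
        (hN _ (hC.1.feasible_subset hy))) ⟨hC.1, hβ⟩ rfl

theorem exists_step_visit (I : Finset (Fin m)) (T : Tableau m) : ∃ C, Step I (.visit T) C := by
  by_cases h : ∀ i ∈ I, ∃ z : ℤ, T.dual i = z
  · exact ⟨_, .finish T h⟩
  · push Not at h
    obtain ⟨i₀, hi₀, hne⟩ := h
    have hne : {k | k ∈ I ∧ ¬ ∃ z : ℤ, T.dual k = z}.Nonempty := ⟨i₀, hi₀, fun ⟨z, hz⟩ => hne z hz⟩
    obtain ⟨r, hr⟩ := T.exists_isLeast_kappa (WellFounded.min wellFounded_lt _ hne)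
    exact ⟨_, .addColumn T _ r ⟨WellFounded.min_mem _ _ hne,
      fun k hk => WellFounded.min_le _ hk⟩ hr⟩

theorem exists_step_solving (I : Finset (Fin m)) (T : Tableau m) :
    ∃ C, Step I (.solving T) C := by
  by_cases hD : T.DualFeasible
  · exact ⟨_, .reoptimized T hD⟩
  · obtain ⟨j, hj⟩ := not_forall.1 hD
    rw [not_le] at hj
    by_cases hu : ∀ l, T.updCol j l ≤ 0
    · exact ⟨_, .detectUnbounded T j hj hu⟩
    · obtain ⟨l, hl⟩ := Tableau.exists_isLeavingRow hu
      exact ⟨_, .pivot T j l hj hl⟩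

end Run

end LexColGen

theorem mainTheorem1 {m n : ℕ} (A : Matrix (Fin m) (Fin n) ℤ) (c : Fin n → ℤ)
    (I : Finset (Fin m)) (hI : I.Nonempty) (hIlead : ∀ i : Fin m, i ∈ I ↔ (i : ℕ) < I.card)
    (hne : (LexColGen.DualLP.ofInt A c).feasible.Nonempty)
    (hbd : Bornology.IsBounded (LexColGen.DualLP.ofInt A c).feasible) :
    -- the algorithm can be started
    (∃ β : Fin m → Fin n,
      LexColGen.Tableau.IsOptimalBasis ⟨LexColGen.DualLP.ofInt A c, β⟩) ∧
    -- and from every optimal starting basis, for all choices of the entering columns,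
    ∀ β : Fin m → Fin n,
      LexColGen.Tableau.IsOptimalBasis ⟨LexColGen.DualLP.ofInt A c, β⟩ →
      -- it performs only finitely many steps,
      (¬ ∃ run : ℕ → LexColGen.Config m,
        run 0 = .visit ⟨LexColGen.DualLP.ofInt A c, β⟩ ∧
        ∀ t, LexColGen.Step I (run t) (run (t + 1))) ∧
      -- and when no further step is possible it has delivered a correct answer
      ∀ C : LexColGen.Config m,
        Relation.ReflTransGen (LexColGen.Step I)
          (.visit ⟨LexColGen.DualLP.ofInt A c, β⟩) C →
        (∀ C', ¬ LexColGen.Step I C C') →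
        (∃ y, C = .solved y ∧ (LexColGen.DualLP.ofInt A c).IsMixedOptimal I y) ∨
        (∃ T x, C = .unbounded T x ∧
          (LexColGen.DualLP.ofInt A c).IsInfeasibilityCertificate I T.lp x ∧
          (LexColGen.DualLP.ofInt A c).mixedFeasible I = ∅) := by
  obtain ⟨R, hR⟩ := hbd.exists_norm_le
  have habs : ∀ y ∈ (LexColGen.DualLP.ofInt A c).feasible, ∀ k, |y k| ≤ ⌈R⌉ := fun y hy k =>
    ((norm_le_pi_norm y k).trans (hR y hy)).trans (Int.le_ceil R)
  refine ⟨LexColGen.DualLP.exists_isOptimalBasis (M := ⌈R⌉ + 1) hne fun y hy k =>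
    (abs_le.1 (habs y hy k)).2.trans_lt (lt_add_one _), fun β hβ => ?_⟩
  have hlower : ∀ i ∈ I, ∀ j < i, j ∈ I := fun i hi j hj =>
    (hIlead j).2 (lt_trans hj ((hIlead i).1 hi))
  have hvalid : (LexColGen.Config.visit ⟨LexColGen.DualLP.ofInt A c, β⟩).Valid
      (LexColGen.DualLP.ofInt A c) I := ⟨.base, hβ⟩
  refine ⟨?_, fun C hC hterminal => ?_⟩
  · rintro ⟨run, h0, hrun⟩
    exact not_acc_iff_exists_descending_chain.2 ⟨run, h0, hrun⟩
      (LexColGen.acc_visit (fun y hy k => (abs_le.1 (habs y hy k)).1) hlower hvalid)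
  · have hCv : C.Valid (LexColGen.DualLP.ofInt A c) I := by
      clear hterminal
      induction hC with
      | refl => exact hvalid
      | tail _ h ih => exact ih.step h
    cases C with
    | visit T => exact absurd (LexColGen.exists_step_visit I T) (not_exists.2 hterminal)
    | solving T => exact absurd (LexColGen.exists_step_solving I T) (not_exists.2 hterminal)
    | solved y => exact .inl ⟨y, rfl, hCv⟩
    | unbounded T x => exact .inr ⟨T, x, rfl, hCv⟩
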